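/- Let $\Gamma$ be a weighted digraph without loops on a finite nonempty vertex set, with $n$ vertices and strictly positive arc weights, where $w_{ij}$ is the weight of the arc $(i,j)$ and $w_{ij}=0$ if there is no such arc. Its Laplacian matrix $L=(\ell_{ij})$ is given by $\ell_{ij}=-w_{ij}$ for $j\ne i$ and $\ell_{ii}=\sum_{k\ne i}w_{ik}$. An in-forest of $\Gamma$ is a spanning subgraph each of whose weak components has one vertex (the root) of outdegree $0$ and all other vertices of outdegree $1$; the weak components are the trees of the in-forest, and each converges to its root. The weight of a subgraph is the product of its arc weights (and $1$ if it has no arcs). Let $d$ be the minimum number of trees in an in-forest of $\Gamma$; the in-forests with $d$ trees are exactly those with the maximum number of arcs, $n-d$. Let $\sigma_{n-d}$ be the total weight of all in-forests with $n-d$ arcs, let $Q_{n-d}$ be the $n\times n$ matrix whose $(i,j)$ entry is the total weight of those in-forests with $n-d$ arcs in which $i$ belongs to a tree converging to $j$, and let $\tilde J=\sigma_{n-d}^{-1}Q_{n-d}$ be the normalized matrix of maximum in-forests. For a square matrix $A$ (over $\mathbb R$ or $\mathbb C$) let $\mathcal R(A)$ and $\mathcal N(A)$ be its range and null space, let $\operatorname{ind}A$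 be the smallest integer $k\ge 0$ with $\operatorname{rank}A^{k+1}=\operatorname{rank}A^k$, and let the eigenprojection of $A$ (at $0$) be the idempotent matrix $B$ with $\mathcal R(B)=\mathcal N(A^\nu)$ and $\mathcal N(B)=\mathcal R(A^\nu)$, where $\nu=\operatorname{ind}A$. Then, over $\mathbb R$ as well as over $\mathbb C$: (i) $L+\tilde J^*$ is nonsingular, where $^*$ denotes the conjugate transpose; (ii) $\operatorname{rank}L=n-\operatorname{rank}\tilde J=n-d$; (iii) $\mathcal N(L)=\mathcal R(\tilde J)$ and $\mathcal R(L)=\mathcal N(\tilde J)$; (iv) $\mathcal R(L)\cap\mathcal R(\tilde J)=\{\mathbf 0\}$; (v) $\operatorname{ind}L=1$; (vi) $\tilde J$ is the eigenprojection of $L$. Moreover (Markov chain tree theorem), for every finite homogeneous Markov chain with row stochastic transition matrix $P$, the limit $P^\infty=\lim_{k\to\infty}\frac1k\sum_{t=0}^{k-1}P^t$ exists and equals the matrix $\tilde J$ of the weighted digraph without loops in which $w_{ij}=P_{ij}$ for $i\ne j$. -/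

import Mathlib

/-- A weighted digraph without loops on the vertex set `V`: `weight i j` is the weight of the arc
from `i` to `j`, and `weight i j = 0` means that there is no such arc. Hence the weights of the
arcs are strictly positive. -/
structure WeightedDigraph (V : Type*) where
  weight : V → V → ℝ
  weight_nonneg : ∀ i j, 0 ≤ weight i j
  weight_self : ∀ i, weight i i = 0

section ArcSets

variable {V : Type*} [DecidableEq V]

/-- The outdegree of `v` in the spanning digraph on `V` with the set of arcs `F`. -/
def arcOutDegree (F : Finset (V × V)) (v : V) : ℕ :=
  (F.filter (fun a => a.1 = v)).card

/-- The undirected graph on `V` that corresponds to the set of arcs `F`. -/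
def arcUnderlying (F : Finset (V × V)) : SimpleGraph V :=
  SimpleGraph.fromRel (fun i j => (i, j) ∈ F)

/-- The digraph on `V` with the set of arcs `F` is a converging forest: in every weak component
one vertex (the root) has outdegree zero and the remaining vertices have outdegree one. -/
def IsConvergingForest (F : Finset (V × V)) : Prop :=
  ∀ C : (arcUnderlying F).ConnectedComponent, ∃ r ∈ C.supp,
    arcOutDegree F r = 0 ∧ ∀ v ∈ C.supp, v ≠ r → arcOutDegree F v = 1

/-- In the converging forest `F`, the vertex `i` belongs to a tree that converges to `j`. -/
def InTreeConvergingTo (F : Finset (V × V)) (i j : V) : Prop :=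
  (arcUnderlying F).Reachable i j ∧ arcOutDegree F j = 0

/-- The number of weak components of the digraph on `V` with the set of arcs `F` (for a
converging forest, the number of its trees). -/
noncomputable def numTrees (F : Finset (V × V)) : ℕ :=
  Nat.card (arcUnderlying F).ConnectedComponent

end ArcSets

namespace WeightedDigraph

variable {V : Type*} [Fintype V] [DecidableEq V] (G : WeightedDigraph V)

open Classical in
/-- The set of arcs. -/
noncomputable def arcs : Finset (V × V) :=
  Finset.univ.filter (fun a => G.weight a.1 a.2 ≠ 0)

open Classical in
/-- The in-forests (spanning converging forests) of `G`, each given by its set of arcs. -/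
noncomputable def inForests : Finset (Finset (V × V)) :=
  G.arcs.powerset.filter (fun F => IsConvergingForest F)

/-- The in-forests with `k` arcs. -/
noncomputable def inForestsWithArcs (k : ℕ) : Finset (Finset (V × V)) :=
  G.inForests.filter (fun F => F.card = k)

/-- The weight of a spanning subgraph is the product of the weights of its arcs. -/
def subgraphWeight (F : Finset (V × V)) : ℝ :=
  ∏ a ∈ F, G.weight a.1 a.2

/-- The total weight of the in-forests with `k` arcs. -/
noncomputable def sigma (k : ℕ) : ℝ :=
  ∑ F ∈ G.inForestsWithArcs k, G.subgraphWeight F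

open Classical in
/-- The matrix of in-forests with `k` arcs: the entry `(i, j)` is the total weight of the
in-forests with `k` arcs in which `i` belongs to a tree converging to `j`. -/
noncomputable def forestMatrix (k : ℕ) : Matrix V V ℝ :=
  Matrix.of fun i j =>
    ∑ F ∈ (G.inForestsWithArcs k).filter (fun F => InTreeConvergingTo F i j), G.subgraphWeight F

/-- The in-forest dimension: the minimum possible number of trees in an in-forest. -/
noncomputable def inForestDim : ℕ :=
  sInf {m | ∃ F ∈ G.inForests, numTrees F = m}

/-- The normalized matrix of maximum in-forests. A maximum in-forest is one with the minimum
number `d` of trees, that is, with `n - d` arcs. -/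
noncomputable def maxForestMatrix : Matrix V V ℝ :=
  (G.sigma (Fintype.card V - G.inForestDim))⁻¹ •
    G.forestMatrix (Fintype.card V - G.inForestDim)

/-- The (row) Laplacian matrix. -/
def laplacian : Matrix V V ℝ :=
  Matrix.of fun i j =>
    if i = j then ∑ k ∈ Finset.univ.erase i, G.weight i k else -G.weight i j

/-- The weighted digraph without loops whose arc weights are the transition probabilities
of the Markov chain with transition matrix `P`. -/
def ofStochastic (P : Matrix V V ℝ) (hP : P ∈ Matrix.rowStochastic ℝ V) : WeightedDigraph V where
  weight i j := if i = j then 0 else P i j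
  weight_nonneg i j := by
    split_ifs
    · exact le_rfl
    · exact hP.1 i j
  weight_self i := if_pos rfl

end WeightedDigraph

section LinearAlgebra

variable {V 𝕜 : Type*} [Fintype V] [DecidableEq V] [Field 𝕜]

/-- The range of a square matrix. -/
def matrixRange (A : Matrix V V 𝕜) : Submodule 𝕜 (V → 𝕜) :=
  LinearMap.range A.mulVecLin

/-- The null space of a square matrix. -/
def matrixNull (A : Matrix V V 𝕜) : Submodule 𝕜 (V → 𝕜) :=
  LinearMap.ker A.mulVecLin

/-- The index of a square matrix: the smallest `k` with `rank (A ^ (k + 1)) = rank (A ^ k)`. -/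
noncomputable def matrixIndex (A : Matrix V V 𝕜) : ℕ :=
  sInf {k | (A ^ (k + 1)).rank = (A ^ k).rank}

/-- `B` is the eigenprojection of `A` at the eigenvalue `0`: the idempotent matrix with range
the null space of `A ^ ν` and null space the range of `A ^ ν`, where `ν` is the index of `A`. -/
def IsEigenprojection (A B : Matrix V V 𝕜) : Prop :=
  IsIdempotentElem B ∧
    matrixRange B = matrixNull (A ^ matrixIndex A) ∧
    matrixNull B = matrixRange (A ^ matrixIndex A)

end LinearAlgebra

/-! Write `L` for the Laplacian, `Q k` for the matrix of in-forests with `k` arcs and `σ k` for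
their total weight. Everything rests on the recurrence `L * Q k = σ (k+1) • 1 - Q (k+1)`
(`laplacian_mul_forestMatrix`), proved by attaching and deleting the arc that leaves a vertex `i`.

Since `Q 0 = 1`, each `Q k` is `σ k • 1 + L * M` with `M` commuting with `L`. At `k = n - d` no
in-forest has `k + 1` arcs, so after division by `σ k > 0` the matrix `J` satisfies `J = 1 + L * M`
and `L * J = 0`. These identities survive the passage to `𝕜` and yield the ranges, null spaces,
index and eigenprojection; the rank of the idempotent `J` is its trace, the number `d` of roots. For
`L = 1 - P` they also give the Cesàro limit, by telescoping. -/

/-! ### Converging forests as functional digraphs -/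

section ForestStructure

open Relation

variable {V : Type*}

/-- There is a directed path from `u` to `v` along the arcs in `F`. -/
def ArcReach (F : Finset (V × V)) (u v : V) : Prop :=
  ReflTransGen (fun x y => (x, y) ∈ F) u v

/-- The vertex `v` has no outgoing arc in `F`. -/
def IsSink (F : Finset (V × V)) (v : V) : Prop :=
  ∀ y, (v, y) ∉ F

/-- Every vertex has at most one outgoing arc and a directed path to a sink. -/
structure IsFunctionalForest (F : Finset (V × V)) : Prop where
  unique : ∀ {v y z}, (v, y) ∈ F → (v, z) ∈ F → y = z
  exists_sink : ∀ v, ∃ r, IsSink F r ∧ ArcReach F v r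

theorem IsSink.eq_of_arcReach {F : Finset (V × V)} {u v : V} (hu : IsSink F u)
    (h : ArcReach F u v) : u = v := by
  rcases ReflTransGen.cases_head h with h | ⟨c, hc, -⟩
  · exact h
  · exact absurd hc (hu c)

theorem IsSink.mono {F F' : Finset (V × V)} (hF : F ⊆ F') {v : V} (h : IsSink F' v) :
    IsSink F v := fun y hy => h y (hF hy)

theorem ArcReach.mono {F F' : Finset (V × V)} (hF : F ⊆ F') {u v : V} (h : ArcReach F u v) :
    ArcReach F' u v := ReflTransGen.mono (r := fun x y => (x, y) ∈ F) (p := fun x y => (x, y) ∈ F') (fun _ _ hxy => hF hxy) _ _ h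

theorem ArcReach.reachable {F : Finset (V × V)} {u v : V} (h : ArcReach F u v) :
    (arcUnderlying F).Reachable u v := by
  induction h with
  | refl => exact SimpleGraph.Reachable.refl _
  | @tail b c _ hbc ih =>
    rcases eq_or_ne b c with rfl | hne
    · exact ih
    · exact ih.trans (SimpleGraph.Adj.reachable ((SimpleGraph.fromRel_adj _ _ _).2
        ⟨hne, Or.inl hbc⟩))

theorem isFunctionalForest_empty : IsFunctionalForest (∅ : Finset (V × V)) :=
  ⟨fun h => absurd h (Finset.notMem_empty _),
    fun v => ⟨v, fun _ => Finset.notMem_empty _, ReflTransGen.refl⟩⟩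

namespace IsFunctionalForest

variable {F : Finset (V × V)}

theorem arcReach_sink_of_arc (hF : IsFunctionalForest F) {u v r : V} (huv : (u, v) ∈ F)
    (hr : IsSink F r) : ArcReach F u r ↔ ArcReach F v r := by
  constructor
  · intro h
    rcases ReflTransGen.cases_head h with rfl | ⟨c, hc, h⟩
    · exact absurd huv (hr v)
    · exact hF.unique hc huv ▸ h
  · exact fun h => ReflTransGen.head huv h

/-- Out-arcs are unique, so the two ends of an arc flow to the same sinks; this propagates along
undirected walks. -/
theorem arcReach_sink_of_reachable (hF : IsFunctionalForest F) {u v r : V}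
    (huv : (arcUnderlying F).Reachable u v) (hr : IsSink F r) :
    ArcReach F u r ↔ ArcReach F v r := by
  obtain ⟨p⟩ := huv
  induction p with
  | nil => rfl
  | cons hadj _ ih =>
    rw [← ih]
    rcases ((SimpleGraph.fromRel_adj _ _ _).1 hadj).2 with h | h
    · exact hF.arcReach_sink_of_arc h hr
    · exact (hF.arcReach_sink_of_arc h hr).symm

open Classical in
theorem numTrees_eq_card_sinks [Fintype V] (hF : IsFunctionalForest F) :
    numTrees F = (Finset.univ.filter (IsSink F)).card := by
  unfold numTrees
  rw [← Fintype.card_subtype, ← Nat.card_eq_fintype_card]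
  refine (Nat.card_congr (Equiv.ofBijective
    (fun r : {r // IsSink F r} => (arcUnderlying F).connectedComponentMk r.1) ⟨?_, ?_⟩)).symm
  · rintro ⟨r, hr⟩ ⟨s, hs⟩ h
    exact Subtype.ext (hr.eq_of_arcReach ((hF.arcReach_sink_of_reachable
      (SimpleGraph.ConnectedComponent.eq.1 h) hs).2 ReflTransGen.refl))
  · intro C
    induction C using SimpleGraph.ConnectedComponent.ind with | _ u
    obtain ⟨r, hr, hur⟩ := hF.exists_sink u
    exact ⟨⟨r, hr⟩, (SimpleGraph.ConnectedComponent.eq.2 hur.reachable).symm⟩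

end IsFunctionalForest

variable [DecidableEq V]

theorem arcOutDegree_eq_zero_iff {F : Finset (V × V)} {v : V} :
    arcOutDegree F v = 0 ↔ IsSink F v := by
  unfold arcOutDegree IsSink
  rw [Finset.card_eq_zero, Finset.filter_eq_empty_iff]
  constructor
  · intro h y hy
    exact h hy rfl
  · rintro h ⟨a, b⟩ hab rfl
    exact h b hab

theorem arcOutDegree_le_one_iff {F : Finset (V × V)} {v : V} :
    arcOutDegree F v ≤ 1 ↔ ∀ y z, (v, y) ∈ F → (v, z) ∈ F → y = z := by
  unfold arcOutDegree
  rw [Finset.card_le_one]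
  constructor
  · intro h y z hy hz
    have := h (v, y) (by simp [hy]) (v, z) (by simp [hz])
    exact (Prod.mk.inj this).2
  · rintro h ⟨a, b⟩ hab ⟨c, d⟩ hcd
    obtain ⟨hb, rfl⟩ := Finset.mem_filter.1 hab
    obtain ⟨hd, h'⟩ := Finset.mem_filter.1 hcd
    obtain rfl : c = a := h'
    exact Prod.ext rfl (h b d hb hd)

namespace IsFunctionalForest

variable {F : Finset (V × V)}

theorem inTreeConvergingTo_iff (hF : IsFunctionalForest F) {u r : V} :
    InTreeConvergingTo F u r ↔ ArcReach F u r ∧ IsSink F r := by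
  unfold InTreeConvergingTo
  rw [arcOutDegree_eq_zero_iff]
  refine and_congr_left fun hr => ⟨fun h => ?_, ArcReach.reachable⟩
  exact (hF.arcReach_sink_of_reachable h hr).2 ReflTransGen.refl

theorem isConvergingForest (hF : IsFunctionalForest F) : IsConvergingForest F := by
  intro C
  induction C using SimpleGraph.ConnectedComponent.ind with | _ u
  obtain ⟨r, hr, hur⟩ := hF.exists_sink u
  refine ⟨r, (SimpleGraph.ConnectedComponent.eq.2 hur.reachable).symm,
    arcOutDegree_eq_zero_iff.2 hr, fun v hv hvr => ?_⟩
  have hvu : (arcUnderlying F).Reachable v u := SimpleGraph.ConnectedComponent.eq.1 hv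
  have h0 : arcOutDegree F v ≠ 0 := fun h =>
    hvr ((arcOutDegree_eq_zero_iff.1 h).eq_of_arcReach
      ((hF.arcReach_sink_of_reachable hvu hr).2 hur))
  have h1 : arcOutDegree F v ≤ 1 := arcOutDegree_le_one_iff.2 fun _ _ => hF.unique
  omega

end IsFunctionalForest

theorem IsConvergingForest.isFunctionalForest {F : Finset (V × V)} (hF : IsConvergingForest F) :
    IsFunctionalForest F := by
  have huniq : ∀ v y z, (v, y) ∈ F → (v, z) ∈ F → y = z := by
    intro v
    rw [← arcOutDegree_le_one_iff]
    obtain ⟨r, -, hr0, hr1⟩ := hF ((arcUnderlying F).connectedComponentMk v)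
    by_cases h : v = r
    · subst h; omega
    · exact (hr1 v rfl h).le
  refine ⟨fun {v y z} => huniq v y z, fun v => ?_⟩
  obtain ⟨r, hrC, hr0, -⟩ := hF ((arcUnderlying F).connectedComponentMk v)
  have hr := arcOutDegree_eq_zero_iff.1 hr0
  refine ⟨r, hr, ?_⟩
  have hreach : (arcUnderlying F).Reachable v r :=
    (SimpleGraph.ConnectedComponent.eq.1 hrC).symm
  obtain ⟨p⟩ := hreach
  clear hrC
  induction p with
  | nil => exact ReflTransGen.refl
  | cons hadj _ ih =>
    have ih := ih hr0 hr
    rcases ((SimpleGraph.fromRel_adj _ _ _).1 hadj).2 with h | h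
    · exact ReflTransGen.head h ih
    -- The edge is traversed against its arc. That arc is the only one leaving the next vertex, so
    -- the directed path from there to `r` begins with it and its tail is the path sought.
    · rcases ReflTransGen.cases_head ih with rfl | ⟨c, hc, h'⟩
      · exact absurd h (hr _)
      · exact huniq _ _ _ hc h ▸ h'

theorem isConvergingForest_iff {F : Finset (V × V)} :
    IsConvergingForest F ↔ IsFunctionalForest F :=
  ⟨fun h => h.isFunctionalForest, fun h => h.isConvergingForest⟩

/-! ### Attaching and deleting one arc -/

/-- Cut the path just before its first use of the new arc. -/
theorem arcReach_insert_or {F : Finset (V × V)} {i a u v : V}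
    (h : ArcReach (insert (i, a) F) u v) : ArcReach F u v ∨ ArcReach F u i := by
  induction h using ReflTransGen.head_induction_on with
  | refl => exact Or.inl ReflTransGen.refl
  | head hbc _ ih =>
    rcases Finset.mem_insert.1 hbc with h | h
    · obtain ⟨rfl, rfl⟩ := Prod.mk.inj h
      exact Or.inr ReflTransGen.refl
    · exact ih.imp (ReflTransGen.head h) (ReflTransGen.head h)

namespace IsFunctionalForest

variable {F : Finset (V × V)} {i a : V}

theorem isSink_insert_iff {v : V} : IsSink (insert (i, a) F) v ↔ IsSink F v ∧ v ≠ i := by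
  simp only [IsSink, Finset.mem_insert, Prod.mk.injEq, not_or, not_and]
  constructor
  · exact fun h => ⟨fun y => (h y).2, fun hv => (h a).1 hv rfl⟩
  · exact fun h y => ⟨fun hv => absurd hv h.2, h.1 y⟩

theorem insert_arc (hF : IsFunctionalForest F) (hi : IsSink F i) (ha : ¬ ArcReach F a i) :
    IsFunctionalForest (insert (i, a) F) := by
  refine ⟨fun {v y z} hy hz => ?_, fun v => ?_⟩
  · rcases Finset.mem_insert.1 hy with hy | hy <;> rcases Finset.mem_insert.1 hz with hz | hz
    · exact (Prod.mk.inj hy).2.trans (Prod.mk.inj hz).2.symm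
    · exact absurd ((Prod.mk.inj hy).1 ▸ hz) (hi z)
    · exact absurd ((Prod.mk.inj hz).1 ▸ hy) (hi y)
    · exact hF.unique hy hz
  · have hsub := Finset.subset_insert (i, a) F
    obtain ⟨s, hs, has⟩ := hF.exists_sink a
    have hsi : s ≠ i := fun h => ha (h ▸ has)
    obtain ⟨r, hr, hvr⟩ := hF.exists_sink v
    by_cases hri : r = i
    · subst hri
      exact ⟨s, isSink_insert_iff.2 ⟨hs, hsi⟩, (hvr.mono hsub).trans
        (ReflTransGen.head (Finset.mem_insert_self _ _) (has.mono hsub))⟩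
    · exact ⟨r, isSink_insert_iff.2 ⟨hr, hri⟩, hvr.mono hsub⟩

theorem isSink_erase (hF : IsFunctionalForest F) (h : (i, a) ∈ F) :
    IsSink (F.erase (i, a)) i := fun y hy => by
  obtain ⟨hne, hy⟩ := Finset.mem_erase.1 hy
  exact hne (by rw [hF.unique hy h])

theorem erase_arc (hF : IsFunctionalForest F) (h : (i, a) ∈ F) :
    IsFunctionalForest (F.erase (i, a)) := by
  refine ⟨fun hy hz => hF.unique (Finset.mem_of_mem_erase hy) (Finset.mem_of_mem_erase hz),
    fun v => ?_⟩
  obtain ⟨r, hr, hvr⟩ := hF.exists_sink v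
  rw [← Finset.insert_erase h] at hvr
  rcases arcReach_insert_or hvr with hvr | hvi
  · exact ⟨r, hr.mono (Finset.erase_subset _ _), hvr⟩
  · exact ⟨i, hF.isSink_erase h, hvi⟩

/-- A path from `a` back to `i` would close a cycle with the arc `(i, a)`. Out-arcs being unique,
nothing leaves the cycle, so `a` could not reach a sink. -/
theorem not_arcReach_erase (hF : IsFunctionalForest F) (h : (i, a) ∈ F) :
    ¬ ArcReach (F.erase (i, a)) a i := by
  intro hai
  obtain ⟨r, hr, har⟩ := hF.exists_sink a
  have key : ∀ x, ArcReach F a x → ArcReach (F.erase (i, a)) x i := by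
    intro x hx
    induction hx with
    | refl => exact hai
    | tail _ hxy ih =>
      rcases ReflTransGen.cases_head ih with rfl | ⟨z, hz, hzi⟩
      · exact hF.unique h hxy ▸ hai
      · exact hF.unique (Finset.mem_of_mem_erase hz) hxy ▸ hzi
  exact hr a ((hr.mono (Finset.erase_subset _ _)).eq_of_arcReach (key r har) ▸ h)

/-- The new arc hangs the whole tree rooted at `i` onto the tree of `a`; all other vertices keep
their root. -/
theorem arcReach_sink_insert_iff (hF : IsFunctionalForest F) (hi : IsSink F i)
    (ha : ¬ ArcReach F a i) {v j : V} :
    (ArcReach (insert (i, a) F) v j ∧ IsSink (insert (i, a) F) j) ↔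
      ((ArcReach F v i ∧ ArcReach F a j) ∨ (¬ ArcReach F v i ∧ ArcReach F v j)) ∧ IsSink F j := by
  have hsub := Finset.subset_insert (i, a) F
  have hF' := hF.insert_arc hi ha
  have hia : (i, a) ∈ insert (i, a) F := Finset.mem_insert_self _ _
  rw [isSink_insert_iff]
  constructor
  · rintro ⟨hvj, hj, hji⟩
    have hj' : IsSink (insert (i, a) F) j := isSink_insert_iff.2 ⟨hj, hji⟩
    refine ⟨?_, hj⟩
    by_cases hvi : ArcReach F v i
    · refine Or.inl ⟨hvi, ?_⟩
      have haj := (hF'.arcReach_sink_of_arc hia hj').1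
        ((hF'.arcReach_sink_of_reachable (hvi.mono hsub).reachable hj').1 hvj)
      exact (arcReach_insert_or haj).resolve_right ha
    · exact Or.inr ⟨hvi, (arcReach_insert_or hvj).resolve_right hvi⟩
  · rintro ⟨⟨hvi, haj⟩ | ⟨hvi, hvj⟩, hj⟩
    · exact ⟨(hvi.mono hsub).trans (ReflTransGen.head hia (haj.mono hsub)), hj,
        fun h => ha (h ▸ haj)⟩
    · exact ⟨hvj.mono hsub, hj, fun h => hvi (h ▸ hvj)⟩

variable [Fintype V]

open Classical in
theorem card_add_card_sinks (hF : IsFunctionalForest F) :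
    F.card + (Finset.univ.filter (IsSink F)).card = Fintype.card V := by
  have h1 : F.card = ∑ v, arcOutDegree F v :=
    Finset.card_eq_sum_card_fiberwise (fun _ _ => Finset.mem_univ _)
  have h2 : ∀ v, arcOutDegree F v + (if IsSink F v then 1 else 0) = 1 := by
    intro v
    have h1 : arcOutDegree F v ≤ 1 := arcOutDegree_le_one_iff.2 fun _ _ => hF.unique
    split_ifs with h
    · rw [arcOutDegree_eq_zero_iff.2 h]
    · have : arcOutDegree F v ≠ 0 := fun h' => h (arcOutDegree_eq_zero_iff.1 h')
      omega
  rw [h1, Finset.card_filter, ← Finset.sum_add_distrib, Finset.sum_congr rfl fun v _ => h2 v]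
  simp

theorem card_add_numTrees (hF : IsFunctionalForest F) :
    F.card + numTrees F = Fintype.card V := by
  rw [hF.numTrees_eq_card_sinks, hF.card_add_card_sinks]

end IsFunctionalForest

end ForestStructure

open Relation Matrix

/-! ### Tree indicators under insertion of an arc -/

section TreeIndicator

variable {V : Type*} [DecidableEq V]

open Classical in
/-- The indicator of the event that `v` belongs to a tree of `F` converging to `j`. -/
noncomputable def treeIndicator (F : Finset (V × V)) (v j : V) : ℝ :=
  if InTreeConvergingTo F v j then 1 else 0

theorem treeIndicator_congr {F F' : Finset (V × V)} {u v j : V}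
    (h : InTreeConvergingTo F u j ↔ InTreeConvergingTo F' v j) :
    treeIndicator F u j = treeIndicator F' v j := by
  rw [treeIndicator, treeIndicator, propext h]

theorem treeIndicator_of_isSink {F : Finset (V × V)} (hF : IsFunctionalForest F) {i : V}
    (hi : IsSink F i) (j : V) : treeIndicator F i j = (1 : Matrix V V ℝ) i j := by
  have h : InTreeConvergingTo F i j ↔ i = j := by
    rw [hF.inTreeConvergingTo_iff]
    exact ⟨fun h => hi.eq_of_arcReach h.1, fun h => h ▸ ⟨ReflTransGen.refl, hi⟩⟩
  simp only [treeIndicator, h, Matrix.one_apply]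

theorem treeIndicator_of_arcReach {F : Finset (V × V)} {u v : V} (h : ArcReach F u v) (j : V) :
    treeIndicator F u j = treeIndicator F v j :=
  treeIndicator_congr (and_congr_left fun _ =>
    ⟨fun h' => h.reachable.symm.trans h', fun h' => h.reachable.trans h'⟩)

theorem treeIndicator_insert_of_arcReach {F : Finset (V × V)} (hF : IsFunctionalForest F)
    {i a : V} (hi : IsSink F i) (ha : ¬ ArcReach F a i) {v : V} (hv : ArcReach F v i) (j : V) :
    treeIndicator (insert (i, a) F) v j = treeIndicator F a j := by
  refine treeIndicator_congr ?_
  rw [(hF.insert_arc hi ha).inTreeConvergingTo_iff, hF.inTreeConvergingTo_iff,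
    hF.arcReach_sink_insert_iff hi ha]
  tauto

theorem treeIndicator_insert_of_not_arcReach {F : Finset (V × V)} (hF : IsFunctionalForest F)
    {i a : V} (hi : IsSink F i) (ha : ¬ ArcReach F a i) {v : V} (hv : ¬ ArcReach F v i) (j : V) :
    treeIndicator (insert (i, a) F) v j = treeIndicator F v j := by
  refine treeIndicator_congr ?_
  rw [(hF.insert_arc hi ha).inTreeConvergingTo_iff, hF.inTreeConvergingTo_iff,
    hF.arcReach_sink_insert_iff hi ha]
  tauto

end TreeIndicator

/-! ### The recurrence for the forest matrices -/

namespace WeightedDigraph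

variable {V : Type*} [Fintype V] (G : WeightedDigraph V)

theorem mem_arcs {a : V × V} : a ∈ G.arcs ↔ G.weight a.1 a.2 ≠ 0 := by
  simp [arcs]

theorem subgraphWeight_pos {F : Finset (V × V)} (hF : F ⊆ G.arcs) : 0 < G.subgraphWeight F :=
  Finset.prod_pos fun _ ha => (G.weight_nonneg _ _).lt_of_ne' (G.mem_arcs.1 (hF ha))

variable [DecidableEq V]

theorem mem_inForests {F : Finset (V × V)} :
    F ∈ G.inForests ↔ F ⊆ G.arcs ∧ IsFunctionalForest F := by
  unfold inForests
  classical
  rw [Finset.mem_filter, Finset.mem_powerset, isConvergingForest_iff]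

theorem mem_inForestsWithArcs {k : ℕ} {F : Finset (V × V)} :
    F ∈ G.inForestsWithArcs k ↔ F ⊆ G.arcs ∧ IsFunctionalForest F ∧ F.card = k := by
  unfold inForestsWithArcs
  rw [Finset.mem_filter, mem_inForests, and_assoc]

theorem forestMatrix_apply (k : ℕ) (i j : V) :
    G.forestMatrix k i j =
      ∑ F ∈ G.inForestsWithArcs k, G.subgraphWeight F * treeIndicator F i j := by
  simp only [forestMatrix, Matrix.of_apply, treeIndicator, mul_ite, mul_one, mul_zero]
  exact @Finset.sum_filter _ _ _ _ _ (Classical.decPred _) _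

open Classical in
/-- Deleting the arc that leaves `i` is a weighted bijection from the in-forests with `k + 1` arcs
in which `i` is not a root onto the pairs of an in-forest with `k` arcs and root `i` and an arc
from `i` to a vertex of another tree. -/
theorem sum_inForests_not_isSink (k : ℕ) (i : V) (φ : Finset (V × V) → ℝ) :
    ∑ F ∈ (G.inForestsWithArcs (k + 1)).filter (fun F => ¬ IsSink F i),
        G.subgraphWeight F * φ F =
      ∑ F ∈ (G.inForestsWithArcs k).filter (fun F => IsSink F i),
        ∑ a ∈ Finset.univ.filter (fun a => ¬ ArcReach F a i),
          G.subgraphWeight F * G.weight i a * φ (insert (i, a) F) := by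
  rw [Finset.sum_sigma']
  -- The sum runs over all `a`, including those for which `(i, a)` is not an arc of `G`; these terms
  -- have weight zero and are dropped before the bijection.
  have hne : ∀ p : (_ : Finset (V × V)) × V, p ∈ ((G.inForestsWithArcs k).filter
      (fun F => IsSink F i)).sigma (fun F => Finset.univ.filter (fun a => ¬ ArcReach F a i)) →
      G.subgraphWeight p.1 * G.weight i p.2 * φ (insert (i, p.2) p.1) ≠ 0 →
        G.weight i p.2 ≠ 0 := fun p _ h h0 => h (by rw [h0, mul_zero, zero_mul])
  rw [← Finset.sum_filter_of_ne hne]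
  symm
  refine Finset.sum_bij (fun p _ => insert (i, p.2) p.1) ?_ ?_ ?_ ?_
  · rintro ⟨F, a⟩ hp
    simp only [Finset.mem_filter, Finset.mem_sigma, mem_inForestsWithArcs, Finset.mem_univ,
      true_and] at hp ⊢
    obtain ⟨⟨⟨⟨hsub, hF, hcard⟩, hi⟩, ha⟩, hw⟩ := hp
    refine ⟨⟨Finset.insert_subset (G.mem_arcs.2 hw) hsub, hF.insert_arc hi ha, ?_⟩,
      fun h => h a (Finset.mem_insert_self _ _)⟩
    rw [Finset.card_insert_of_notMem (hi a), hcard]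
  · rintro ⟨F, a⟩ hp ⟨F', a'⟩ hp' h
    simp only [Finset.mem_filter, Finset.mem_sigma, mem_inForestsWithArcs, Finset.mem_univ,
      true_and] at hp hp' h
    obtain ⟨⟨⟨⟨-, hF, -⟩, hi⟩, ha⟩, -⟩ := hp
    obtain ⟨⟨⟨⟨-, -, -⟩, hi'⟩, -⟩, -⟩ := hp'
    obtain rfl : a = a' := (hF.insert_arc hi ha).unique (Finset.mem_insert_self _ _)
      (h ▸ Finset.mem_insert_self _ _)
    obtain rfl : F = F' := by
      rw [← Finset.erase_insert (hi a), h, Finset.erase_insert (hi' a)]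
    rfl
  · intro F hF
    simp only [Finset.mem_filter, mem_inForestsWithArcs] at hF
    obtain ⟨⟨hsub, hF, hcard⟩, hi⟩ := hF
    obtain ⟨a, ha⟩ : ∃ a, (i, a) ∈ F := by
      by_contra h
      exact hi fun a ha => h ⟨a, ha⟩
    refine ⟨⟨F.erase (i, a), a⟩, ?_, Finset.insert_erase ha⟩
    simp only [Finset.mem_filter, Finset.mem_sigma, mem_inForestsWithArcs, Finset.mem_univ,
      true_and]
    refine ⟨⟨⟨⟨(Finset.erase_subset _ _).trans hsub, hF.erase_arc ha, ?_⟩, hF.isSink_erase ha⟩,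
      hF.not_arcReach_erase ha⟩, G.mem_arcs.1 (hsub ha)⟩
    rw [Finset.card_erase_of_mem ha, hcard, Nat.add_sub_cancel]
  · rintro ⟨F, a⟩ hp
    simp only [Finset.mem_filter, Finset.mem_sigma, mem_inForestsWithArcs] at hp
    obtain ⟨⟨⟨-, hi⟩, -⟩, -⟩ := hp
    simp only [subgraphWeight]
    rw [Finset.prod_insert (hi a), mul_comm (G.weight i a)]

theorem laplacian_mul_apply (A : Matrix V V ℝ) (i j : V) :
    (G.laplacian * A) i j = ∑ a, G.weight i a * (A i j - A a j) := by
  have hL : ∀ a, G.laplacian i a = (if i = a then ∑ b, G.weight i b else 0) - G.weight i a := by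
    intro a
    simp only [laplacian, Matrix.of_apply]
    split_ifs with h
    · subst h
      rw [← Finset.add_sum_erase _ _ (Finset.mem_univ i), G.weight_self]
      ring
    · ring
  simp only [Matrix.mul_apply, hL, sub_mul, ite_mul, zero_mul, Finset.sum_sub_distrib, mul_sub,
    Finset.sum_ite_eq, Finset.mem_univ, if_true, Finset.sum_mul]

/-- The `(i, j)` entry of the product of the Laplacian matrix and the matrix of tree indicators
of `F`. -/
noncomputable def treeFlow (F : Finset (V × V)) (i j : V) : ℝ :=
  ∑ a, G.weight i a * (treeIndicator F i j - treeIndicator F a j)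

theorem laplacian_mul_forestMatrix_apply (k : ℕ) (i j : V) :
    (G.laplacian * G.forestMatrix k) i j =
      ∑ F ∈ G.inForestsWithArcs k, G.subgraphWeight F * G.treeFlow F i j := by
  rw [laplacian_mul_apply]
  simp only [forestMatrix_apply, treeFlow, ← Finset.sum_sub_distrib, Finset.mul_sum]
  rw [Finset.sum_comm]
  refine Finset.sum_congr rfl fun F _ => Finset.sum_congr rfl fun a _ => ?_
  ring

open Classical in
theorem treeFlow_eq_sum_filter {F : Finset (V × V)} {i : V} (j : V) :
    G.treeFlow F i j = ∑ a ∈ Finset.univ.filter (fun a => ¬ ArcReach F a i),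
      G.weight i a * (treeIndicator F i j - treeIndicator F a j) := by
  unfold treeFlow
  rw [Finset.sum_filter_of_ne]
  intro a _ h hai
  exact h (by rw [treeIndicator_of_arcReach hai j, sub_self, mul_zero])

-- When `i` is a root, each term of the flow attaches an arc `(i, a)` to another tree, and in the
-- enlarged forest `i` has the root of `a`.
open Classical in
theorem sum_isSink_mul_treeFlow (k : ℕ) (i j : V) :
    ∑ F ∈ (G.inForestsWithArcs k).filter (fun F => IsSink F i),
        G.subgraphWeight F * G.treeFlow F i j =
      ∑ F ∈ (G.inForestsWithArcs (k + 1)).filter (fun F => ¬ IsSink F i),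
        G.subgraphWeight F * ((1 : Matrix V V ℝ) i j - treeIndicator F i j) := by
  rw [G.sum_inForests_not_isSink k i fun F => (1 : Matrix V V ℝ) i j - treeIndicator F i j]
  refine Finset.sum_congr rfl fun F hF => ?_
  obtain ⟨hF, hi⟩ := Finset.mem_filter.1 hF
  obtain ⟨-, hF, -⟩ := G.mem_inForestsWithArcs.1 hF
  rw [treeFlow_eq_sum_filter, Finset.mul_sum]
  refine Finset.sum_congr rfl fun a ha => ?_
  rw [treeIndicator_insert_of_arcReach hF hi (Finset.mem_filter.1 ha).2 ReflTransGen.refl,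
    treeIndicator_of_isSink hF hi, mul_assoc]

-- Delete the arc leaving `i` and sum over all its replacements `(i, b)`. With `(i, b)` in place,
-- the tree of `i` takes the indicator of `b`, which leaves a double sum over `a, b` antisymmetric
-- under their exchange.
open Classical in
theorem sum_not_isSink_mul_treeFlow (k : ℕ) (i j : V) :
    ∑ F ∈ (G.inForestsWithArcs k).filter (fun F => ¬ IsSink F i),
        G.subgraphWeight F * G.treeFlow F i j = 0 := by
  cases k with
  | zero =>
    refine Finset.sum_eq_zero fun F hF => ?_
    obtain ⟨hF, hi⟩ := Finset.mem_filter.1 hF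
    obtain ⟨-, -, hcard⟩ := G.mem_inForestsWithArcs.1 hF
    rw [Finset.card_eq_zero.1 hcard] at hi
    exact absurd (fun _ => Finset.notMem_empty _) hi
  | succ k =>
    rw [G.sum_inForests_not_isSink k i fun F => G.treeFlow F i j]
    refine Finset.sum_eq_zero fun F hF => ?_
    obtain ⟨hF, hi⟩ := Finset.mem_filter.1 hF
    obtain ⟨-, hF, -⟩ := G.mem_inForestsWithArcs.1 hF
    set S := Finset.univ.filter (fun a => ¬ ArcReach F a i) with hS
    have hflow : ∀ b ∈ S, G.treeFlow (insert (i, b) F) i j =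
        ∑ a ∈ S, G.weight i a * (treeIndicator F b j - treeIndicator F a j) := by
      intro b hb
      have hb := (Finset.mem_filter.1 hb).2
      rw [hS, Finset.sum_filter]
      refine Finset.sum_congr rfl fun a _ => ?_
      rw [treeIndicator_insert_of_arcReach hF hi hb ReflTransGen.refl]
      split_ifs with ha
      · rw [treeIndicator_insert_of_arcReach hF hi hb ha, sub_self, mul_zero]
      · rw [treeIndicator_insert_of_not_arcReach hF hi hb ha]
    have hsum : ∑ b ∈ S, G.weight i b * G.treeFlow (insert (i, b) F) i j = 0 := by
      rw [Finset.sum_congr rfl fun b hb => by rw [hflow b hb, Finset.mul_sum]]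
      have hanti : ∑ b ∈ S, ∑ a ∈ S, G.weight i b *
          (G.weight i a * (treeIndicator F b j - treeIndicator F a j)) =
          -∑ b ∈ S, ∑ a ∈ S, G.weight i b *
          (G.weight i a * (treeIndicator F b j - treeIndicator F a j)) := by
        conv_lhs => rw [Finset.sum_comm]
        simp only [← Finset.sum_neg_distrib]
        refine Finset.sum_congr rfl fun b _ => Finset.sum_congr rfl fun a _ => ?_
        ring
      linarith
    simp only [mul_assoc, ← Finset.mul_sum, hsum, mul_zero]

/-- Only forests with root `i` contribute on the left. On the right, those with root `i` cancel,
because there the indicator row of `i` is the identity row. -/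
theorem laplacian_mul_forestMatrix (k : ℕ) :
    G.laplacian * G.forestMatrix k = G.sigma (k + 1) • 1 - G.forestMatrix (k + 1) := by
  classical
  ext i j
  rw [laplacian_mul_forestMatrix_apply, Matrix.sub_apply, Matrix.smul_apply, smul_eq_mul,
    forestMatrix_apply, sigma, Finset.sum_mul, ← Finset.sum_sub_distrib,
    ← Finset.sum_filter_add_sum_filter_not _ (fun F => IsSink F i),
    sum_isSink_mul_treeFlow, sum_not_isSink_mul_treeFlow, add_zero,
    ← Finset.sum_filter_add_sum_filter_not (G.inForestsWithArcs (k + 1)) (fun F => IsSink F i)]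
  rw [Finset.sum_eq_zero (s := (G.inForestsWithArcs (k + 1)).filter (fun F => IsSink F i)),
    zero_add]
  · exact Finset.sum_congr rfl fun F _ => mul_sub _ _ _
  · intro F hF
    obtain ⟨hF, hi⟩ := Finset.mem_filter.1 hF
    rw [treeIndicator_of_isSink (G.mem_inForestsWithArcs.1 hF).2.1 hi, sub_self]

theorem inForestsWithArcs_zero : G.inForestsWithArcs 0 = {∅} := by
  ext F
  rw [mem_inForestsWithArcs, Finset.mem_singleton, Finset.card_eq_zero]
  refine ⟨fun h => h.2.2, ?_⟩
  rintro rfl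
  exact ⟨Finset.empty_subset _, isFunctionalForest_empty, rfl⟩

theorem forestMatrix_zero : G.forestMatrix 0 = 1 := by
  ext i j
  rw [forestMatrix_apply, inForestsWithArcs_zero, Finset.sum_singleton,
    treeIndicator_of_isSink isFunctionalForest_empty fun _ => Finset.notMem_empty _]
  simp [subgraphWeight]

/-- The matrix of in-forests is a polynomial in the Laplacian matrix with constant term `sigma`. -/
theorem exists_forestMatrix_eq (k : ℕ) : ∃ M, Commute G.laplacian M ∧
    G.forestMatrix k = G.sigma k • 1 + G.laplacian * M := by
  induction k with
  | zero =>
    refine ⟨0, Commute.zero_right _, ?_⟩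
    rw [forestMatrix_zero, mul_zero, add_zero, sigma, inForestsWithArcs_zero]
    simp [subgraphWeight]
  | succ k ih =>
    obtain ⟨M, hM, h⟩ := ih
    -- The recurrence solved for the next matrix; the witness commutes with `L` by the induction
    -- hypothesis.
    refine ⟨-G.forestMatrix k, ?_, ?_⟩
    · rw [h]
      exact (((Commute.one_right _).smul_right _).add_right
        ((Commute.refl _).mul_right hM)).neg_right
    · rw [mul_neg, laplacian_mul_forestMatrix]
      abel

/-! ### Maximum in-forests -/

theorem inForestDim_mem : G.inForestDim ∈ {m | ∃ F ∈ G.inForests, numTrees F = m} :=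
  Nat.sInf_mem ⟨_, ∅, G.mem_inForests.2 ⟨Finset.empty_subset _, isFunctionalForest_empty⟩, rfl⟩

theorem inForestDim_le_card : G.inForestDim ≤ Fintype.card V := by
  obtain ⟨F, hF, h⟩ := G.inForestDim_mem
  have := (G.mem_inForests.1 hF).2.card_add_numTrees
  omega

theorem sigma_pos : 0 < G.sigma (Fintype.card V - G.inForestDim) := by
  obtain ⟨F, hF, h⟩ := G.inForestDim_mem
  obtain ⟨hsub, hF⟩ := G.mem_inForests.1 hF
  have := hF.card_add_numTrees
  exact Finset.sum_pos (fun F hF => G.subgraphWeight_pos (G.mem_inForestsWithArcs.1 hF).1)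
    ⟨F, G.mem_inForestsWithArcs.2 ⟨hsub, hF, by omega⟩⟩

theorem inForestsWithArcs_eq_empty :
    G.inForestsWithArcs (Fintype.card V - G.inForestDim + 1) = ∅ := by
  refine Finset.eq_empty_of_forall_notMem fun F hF => ?_
  obtain ⟨hsub, hF, hcard⟩ := G.mem_inForestsWithArcs.1 hF
  have h1 := hF.card_add_numTrees
  have h2 : G.inForestDim ≤ numTrees F :=
    Nat.sInf_le ⟨F, G.mem_inForests.2 ⟨hsub, hF⟩, rfl⟩
  omega

theorem laplacian_mul_maxForestMatrix : G.laplacian * G.maxForestMatrix = 0 := by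
  rw [maxForestMatrix, Matrix.mul_smul, laplacian_mul_forestMatrix]
  have : G.forestMatrix (Fintype.card V - G.inForestDim + 1) = 0 := by
    ext i j
    rw [forestMatrix_apply, inForestsWithArcs_eq_empty, Finset.sum_empty, Matrix.zero_apply]
  have hσ : G.sigma (Fintype.card V - G.inForestDim + 1) = 0 := by
    rw [sigma, inForestsWithArcs_eq_empty, Finset.sum_empty]
  rw [this, hσ, zero_smul, sub_zero, smul_zero]

theorem exists_maxForestMatrix_eq : ∃ M, Commute G.laplacian M ∧
    G.maxForestMatrix = 1 + G.laplacian * M := by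
  obtain ⟨M, hM, h⟩ := G.exists_forestMatrix_eq (Fintype.card V - G.inForestDim)
  refine ⟨(G.sigma (Fintype.card V - G.inForestDim))⁻¹ • M, hM.smul_right _, ?_⟩
  rw [maxForestMatrix, h, smul_add, smul_smul, inv_mul_cancel₀ G.sigma_pos.ne', one_smul,
    Matrix.mul_smul]

/-- A vertex lies in a tree converging to itself exactly when it is a root, and every maximum
in-forest has `d` roots. -/
theorem trace_maxForestMatrix : G.maxForestMatrix.trace = G.inForestDim := by
  classical
  have htr : (G.forestMatrix (Fintype.card V - G.inForestDim)).trace =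
      G.sigma (Fintype.card V - G.inForestDim) * G.inForestDim := by
    simp only [Matrix.trace, Matrix.diag_apply, forestMatrix_apply]
    rw [Finset.sum_comm, sigma, Finset.sum_mul]
    refine Finset.sum_congr rfl fun F hF => ?_
    obtain ⟨-, hF, hcard⟩ := G.mem_inForestsWithArcs.1 hF
    rw [← Finset.mul_sum]
    congr 1
    have h1 := hF.card_add_card_sinks
    have h2 := G.inForestDim_le_card
    have h3 : G.inForestDim = (Finset.univ.filter (IsSink F)).card := by omega
    rw [h3, Finset.card_filter, Nat.cast_sum]
    refine Finset.sum_congr rfl fun v _ => ?_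
    unfold treeIndicator
    rw [hF.inTreeConvergingTo_iff]
    simp [ArcReach, ReflTransGen.refl]
  rw [maxForestMatrix, Matrix.trace_smul, htr, smul_eq_mul,
    inv_mul_cancel_left₀ G.sigma_pos.ne']

end WeightedDigraph

/-! ### Linear algebra of `J = 1 + L * M`, `L * J = 0` -/

section Projection

open Matrix

variable {V 𝕜 : Type*} [Fintype V] [DecidableEq V]

section Field

variable [Field 𝕜] {L J M : Matrix V V 𝕜}

theorem mul_eq_zero_of_eq_one_add (hM : Commute L M) (hJ : J = 1 + L * M) (hLJ : L * J = 0) :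
    J * L = 0 := by
  have : J * L = L * J := by
    rw [hJ, add_mul, mul_add, one_mul, mul_one, mul_assoc, ← hM.eq]
  rw [this, hLJ]

theorem isIdempotentElem_of_eq_one_add (hM : Commute L M) (hJ : J = 1 + L * M)
    (hLJ : L * J = 0) : IsIdempotentElem J := by
  change J * J = J
  nth_rw 2 [hJ]
  rw [mul_add, mul_one, ← mul_assoc, mul_eq_zero_of_eq_one_add hM hJ hLJ, zero_mul, add_zero]

theorem matrixNull_eq_matrixRange (hM : Commute L M) (hJ : J = 1 + L * M) (hLJ : L * J = 0) :
    matrixNull L = matrixRange J := by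
  ext x
  simp only [matrixNull, matrixRange, LinearMap.mem_ker, LinearMap.mem_range, mulVecLin_apply]
  constructor
  · intro hx
    refine ⟨x, ?_⟩
    rw [hJ, hM.eq, add_mulVec, one_mulVec, ← mulVec_mulVec, hx, mulVec_zero, add_zero]
  · rintro ⟨y, rfl⟩
    rw [mulVec_mulVec, hLJ, zero_mulVec]

theorem matrixRange_eq_matrixNull (hM : Commute L M) (hJ : J = 1 + L * M) (hLJ : L * J = 0) :
    matrixRange L = matrixNull J := by
  ext x
  simp only [matrixNull, matrixRange, LinearMap.mem_ker, LinearMap.mem_range, mulVecLin_apply]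
  constructor
  · rintro ⟨y, rfl⟩
    rw [mulVec_mulVec, mul_eq_zero_of_eq_one_add hM hJ hLJ, zero_mulVec]
  · intro hx
    rw [hJ, add_mulVec, one_mulVec] at hx
    exact ⟨-(M *ᵥ x), by rw [mulVec_neg, mulVec_mulVec, ← eq_neg_of_add_eq_zero_left hx]⟩

theorem matrixRange_inf_matrixRange (hM : Commute L M) (hJ : J = 1 + L * M) (hLJ : L * J = 0) :
    matrixRange L ⊓ matrixRange J = ⊥ := by
  rw [matrixRange_eq_matrixNull hM hJ hLJ, eq_bot_iff]
  rintro x ⟨hx, y, rfl⟩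
  simp only [matrixNull, SetLike.mem_coe, LinearMap.mem_ker, mulVecLin_apply, mulVec_mulVec,
    (isIdempotentElem_of_eq_one_add hM hJ hLJ).eq] at hx
  exact hx

theorem rank_add_rank (hM : Commute L M) (hJ : J = 1 + L * M) (hLJ : L * J = 0) :
    L.rank + J.rank = Fintype.card V := by
  have h := LinearMap.finrank_range_add_finrank_ker J.mulVecLin
  have hr : LinearMap.range L.mulVecLin = LinearMap.ker J.mulVecLin :=
    matrixRange_eq_matrixNull hM hJ hLJ
  rw [Module.finrank_fintype_fun_eq_card] at h
  rw [Matrix.rank, hr, add_comm]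
  exact h

theorem rank_eq_trace_of_isIdempotentElem (hJ : IsIdempotentElem J) : (J.rank : 𝕜) = J.trace := by
  have hlin : IsIdempotentElem J.mulVecLin := by
    change J.mulVecLin ∘ₗ J.mulVecLin = J.mulVecLin
    rw [← mulVecLin_mul, hJ.eq]
  rw [← Matrix.trace_toLin'_eq, Matrix.rank]
  exact (LinearMap.IsProj.trace (LinearMap.IsIdempotentElem.isProj_range _ hlin)).symm

/-- Expanding `L * J = 0` gives `L = -L² M`, so squaring loses no rank; singularity of `L` excludes
index zero. -/
theorem matrixIndex_eq_one (hJ : J = 1 + L * M) (hLJ : L * J = 0)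
    (hrank : L.rank < Fintype.card V) : matrixIndex L = 1 := by
  have hL : L = L ^ 2 * -M := by
    have h : L + L * L * M = 0 := by
      rw [← hLJ, hJ, mul_add, mul_one, mul_assoc]
    rw [mul_neg, pow_two]
    exact eq_neg_of_add_eq_zero_left h
  have h1 : (L ^ (1 + 1)).rank = (L ^ 1).rank := by
    rw [pow_one]
    refine le_antisymm ?_ ?_
    · rw [one_add_one_eq_two, pow_two]
      exact rank_mul_le_left _ _
    · conv_lhs => rw [hL]
      exact rank_mul_le_left _ _
  refine le_antisymm (Nat.sInf_le h1) (Nat.one_le_iff_ne_zero.2 fun h0 => ?_)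
  -- `sInf ∅ = 0` in `ℕ`, so the empty set must be excluded too; `h1` does this.
  rcases Nat.sInf_eq_zero.1 h0 with h | h
  · have h : (L ^ (0 + 1)).rank = (L ^ 0).rank := h
    rw [zero_add, pow_one, pow_zero, rank_one] at h
    omega
  · exact Set.notMem_empty 1 (h ▸ h1)

end Field

-- If `(L + Jᴴ) x = 0`, applying `J` kills `L` and gives `J Jᴴ x = 0`, so `Jᴴ x = 0` and `L x = 0`.
-- Then `J x = x`, hence `Jᴴ J x = 0` and `x = J x = 0`.
open scoped ComplexOrder in
theorem isUnit_add_conjTranspose [RCLike 𝕜] {L J M : Matrix V V 𝕜} (hM : Commute L M)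
    (hJ : J = 1 + L * M) (hLJ : L * J = 0) : IsUnit (L + Jᴴ) := by
  rw [← mulVec_injective_iff_isUnit, ← coe_mulVecLin, ← LinearMap.ker_eq_bot, eq_bot_iff]
  intro x hx
  rw [LinearMap.mem_ker, mulVecLin_apply] at hx
  have hstar : Jᴴ *ᵥ x = 0 := by
    have h := congrArg (J *ᵥ ·) hx
    simp only [mulVec_mulVec, mul_add, mul_eq_zero_of_eq_one_add hM hJ hLJ, zero_add,
      mulVec_zero] at h
    exact (self_mul_conjTranspose_mulVec_eq_zero J x).1 h
  rw [add_mulVec, hstar, add_zero] at hx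
  have hJx : J *ᵥ x = x := by
    rw [hJ, hM.eq, add_mulVec, one_mulVec, ← mulVec_mulVec, hx, mulVec_zero, add_zero]
  have h : (Jᴴ * J) *ᵥ x = 0 := by rw [← mulVec_mulVec, hJx, hstar]
  rw [conjTranspose_mul_self_mulVec_eq_zero, hJx] at h
  exact h

/-- The Cesàro means of the powers of a row stochastic matrix converge to the projection onto the
null space of `1 - P` along its range. -/
theorem tendsto_cesaro_of_mem_rowStochastic {P J M : Matrix V V ℝ}
    (hP : P ∈ rowStochastic ℝ V) (hJ : J = 1 + (1 - P) * M) (hPJ : (1 - P) * J = 0) :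
    Filter.Tendsto (fun k : ℕ => (k : ℝ)⁻¹ • ∑ t ∈ Finset.range k, P ^ t) Filter.atTop
      (nhds J) := by
  have hPJ' : P * J = J := by
    rw [sub_mul, one_mul, sub_eq_zero] at hPJ
    exact hPJ.symm
  have hpow : ∀ t : ℕ, P ^ t * J = J := by
    intro t
    induction t with
    | zero => rw [pow_zero, one_mul]
    | succ t ih => rw [pow_succ, mul_assoc, hPJ', ih]
  -- Multiply by `1 = J - (1 - P) * M`: powers of `P` fix `J`, and the other part telescopes.
  have hsum : ∀ k : ℕ, ∑ t ∈ Finset.range k, P ^ t = (k : ℝ) • J - (1 - P ^ k) * M := by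
    intro k
    have h1 : (1 : Matrix V V ℝ) = J - (1 - P) * M := by rw [hJ, add_sub_cancel_right]
    calc ∑ t ∈ Finset.range k, P ^ t
        = (∑ t ∈ Finset.range k, P ^ t) * (J - (1 - P) * M) := by rw [← h1, mul_one]
      _ = _ := by
        rw [mul_sub, ← mul_assoc, geom_sum_mul_neg, Finset.sum_mul,
          Finset.sum_congr rfl fun t _ => hpow t, Finset.sum_const, Finset.card_range,
          Nat.cast_smul_eq_nsmul]
  have hzero : Filter.Tendsto (fun k : ℕ => (k : ℝ)⁻¹ • (1 - P ^ k)) Filter.atTop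
      (nhds (0 : Matrix V V ℝ)) := by
    -- Powers of `P` are stochastic, so the entries of `1 - P ^ k` stay in `[-1, 1]`.
    refine tendsto_pi_nhds.2 fun i => tendsto_pi_nhds.2 fun j => ?_
    refine squeeze_zero_norm (fun k => ?_) (tendsto_inv_atTop_nhds_zero_nat (𝕜 := ℝ))
    have h0 := nonneg_of_mem_rowStochastic (pow_mem hP k) (i := i) (j := j)
    have h1 := le_one_of_mem_rowStochastic (pow_mem hP k) (i := i) (j := j)
    have h2 := nonneg_of_mem_rowStochastic (one_mem (rowStochastic ℝ V)) (i := i) (j := j)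
    have h3 := le_one_of_mem_rowStochastic (one_mem (rowStochastic ℝ V)) (i := i) (j := j)
    rw [Matrix.smul_apply, Matrix.sub_apply, smul_eq_mul, norm_mul, Real.norm_of_nonneg (by positivity)]
    refine mul_le_of_le_one_right (by positivity) ?_
    rw [Real.norm_eq_abs, abs_le]
    constructor <;> linarith
  have hlim : Filter.Tendsto (fun k : ℕ => J - ((k : ℝ)⁻¹ • (1 - P ^ k)) * M) Filter.atTop
      (nhds J) := by
    have hc : Continuous fun A : Matrix V V ℝ => J - A * M :=
      continuous_const.sub (continuous_id.matrix_mul continuous_const)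
    have h := (hc.tendsto 0).comp hzero
    rwa [zero_mul, sub_zero] at h
  refine hlim.congr' ?_
  filter_upwards [Filter.eventually_ne_atTop 0] with k hk
  have hk : (k : ℝ) ≠ 0 := Nat.cast_ne_zero.2 hk
  rw [hsum, smul_sub (k : ℝ)⁻¹ (_ • J), smul_smul, inv_mul_cancel₀ hk, one_smul, Matrix.smul_mul]

end Projection

/-! ### Positive forest dimension, Markov chains and the final assembly -/

namespace WeightedDigraph

open Matrix

variable {V : Type*} [Fintype V] [DecidableEq V]

/-- Makes the Laplacian singular, as the index computation requires. -/
theorem inForestDim_pos [Nonempty V] (G : WeightedDigraph V) : 0 < G.inForestDim := by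
  obtain ⟨F, -, h⟩ := G.inForestDim_mem
  have : Nonempty (arcUnderlying F).ConnectedComponent :=
    Nonempty.map (arcUnderlying F).connectedComponentMk inferInstance
  rw [← h]
  exact Nat.card_pos

theorem laplacian_ofStochastic (P : Matrix V V ℝ) (hP : P ∈ rowStochastic ℝ V) :
    (ofStochastic P hP).laplacian = 1 - P := by
  ext i j
  rw [Matrix.sub_apply, one_apply]
  simp only [laplacian, ofStochastic, of_apply]
  split_ifs with h
  · subst h
    rw [← sum_row_of_mem_rowStochastic hP i, ← Finset.add_sum_erase _ _ (Finset.mem_univ i),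
      add_sub_cancel_left]
    exact Finset.sum_congr rfl fun k hk => if_neg (Finset.ne_of_mem_erase hk).symm
  · rw [zero_sub]

end WeightedDigraph

theorem proposition12 {V 𝕜 : Type*} [Fintype V] [DecidableEq V] [Nonempty V] [RCLike 𝕜] :
    -- the Laplacian matrix and the normalized matrix of maximum in-forests,
    -- regarded as matrices over `𝕜` (the real or the complex numbers)
    (∀ (G : WeightedDigraph V) (L J : Matrix V V 𝕜),
      L = G.laplacian.map (algebraMap ℝ 𝕜) →
      J = G.maxForestMatrix.map (algebraMap ℝ 𝕜) →
        IsUnit (L + J.conjTranspose) ∧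
        (L.rank + J.rank = Fintype.card V ∧ L.rank + G.inForestDim = Fintype.card V) ∧
        (matrixNull L = matrixRange J ∧ matrixRange L = matrixNull J) ∧
        matrixRange L ⊓ matrixRange J = ⊥ ∧
        matrixIndex L = 1 ∧
        IsEigenprojection L J) ∧
    -- the Markov chain tree theorem
    (∀ (P : Matrix V V ℝ) (hP : P ∈ Matrix.rowStochastic ℝ V),
      Filter.Tendsto (fun k : ℕ => (k : ℝ)⁻¹ • ∑ t ∈ Finset.range k, P ^ t) Filter.atTop
        (nhds (WeightedDigraph.ofStochastic P hP).maxForestMatrix)) := by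
  refine ⟨?_, fun P hP => ?_⟩
  · rintro G L J rfl rfl
    obtain ⟨M, hM, hJ⟩ := G.exists_maxForestMatrix_eq
    let f : Matrix V V ℝ →+* Matrix V V 𝕜 := (algebraMap ℝ 𝕜).mapMatrix
    have hM' : Commute (f G.laplacian) (f M) := hM.map f
    have hJ' : f G.maxForestMatrix = 1 + f G.laplacian * f M := by
      rw [hJ, map_add, map_one, map_mul]
    have hLJ' : f G.laplacian * f G.maxForestMatrix = 0 := by
      rw [← map_mul, G.laplacian_mul_maxForestMatrix, map_zero]
    have hidem := isIdempotentElem_of_eq_one_add hM' hJ' hLJ'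
    have hrank := rank_add_rank hM' hJ' hLJ'
    have hdim : (f G.maxForestMatrix).rank = G.inForestDim := by
      have h := rank_eq_trace_of_isIdempotentElem hidem
      have htr : (f G.maxForestMatrix).trace = algebraMap ℝ 𝕜 G.maxForestMatrix.trace :=
        (AddMonoidHom.map_trace (algebraMap ℝ 𝕜).toAddMonoidHom G.maxForestMatrix).symm
      rw [htr, G.trace_maxForestMatrix, map_natCast] at h
      exact_mod_cast h
    have hpos := G.inForestDim_pos
    have hindex := matrixIndex_eq_one hJ' hLJ' (by omega)
    have hnull := matrixNull_eq_matrixRange hM' hJ' hLJ'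
    have hrange := matrixRange_eq_matrixNull hM' hJ' hLJ'
    refine ⟨isUnit_add_conjTranspose hM' hJ' hLJ', ⟨hrank, hdim ▸ hrank⟩, ⟨hnull, hrange⟩,
      matrixRange_inf_matrixRange hM' hJ' hLJ', hindex, hidem, ?_, ?_⟩
    · change matrixRange (f G.maxForestMatrix) =
        matrixNull (f G.laplacian ^ matrixIndex (f G.laplacian))
      rw [hindex, pow_one, hnull]
    · change matrixNull (f G.maxForestMatrix) =
        matrixRange (f G.laplacian ^ matrixIndex (f G.laplacian))
      rw [hindex, pow_one, hrange]
  · obtain ⟨M, -, hJ⟩ := (WeightedDigraph.ofStochastic P hP).exists_maxForestMatrix_eq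
    have hLJ := (WeightedDigraph.ofStochastic P hP).laplacian_mul_maxForestMatrix
    rw [WeightedDigraph.laplacian_ofStochastic] at hJ hLJ
    exact tendsto_cesaro_of_mem_rowStochastic hP hJ hLJ
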